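/- Let $M$ be a connected, paracompact, Hausdorff smooth ($C^\infty$) manifold without boundary of finite dimension $m$. For a smooth Koszul connection $\nabla$ on $TM$ put $$T^\nabla(X,Y)=\nabla_XY-\nabla_YX-[X,Y],\qquad R^\nabla(X,Y)Z=\nabla_X\nabla_YZ-\nabla_Y\nabla_XZ-\nabla_{[X,Y]}Z,$$ $$(\nabla^2X)(Y,Z)=\nabla_Y\nabla_ZX-\nabla_{\nabla_YZ}X.$$ For $x\in M$ let $\mathcal T_\nabla M(x)\subset T_xM$ be the linear span of the values $X(x)$ of all smooth vector fields $X$ that are defined on some open neighbourhood of $x$ and satisfy $\nabla^2X=0$ there. Define $$r^b(\nabla)=\min_{x\in M}\dim \mathcal T_\nabla M(x),\qquad r^b(M)=\min_{\nabla}\bigl(m-r^b(\nabla)\bigr),$$ where the last minimum runs over all smooth torsion-free connections ($T^\nabla=0$) on $TM$. A locally flat structure on $M$ is a smooth connection $\nabla$ on $TM$ with $T^\nabla=0$ and $R^\nabla=0$. Then the following are equivalent: 1. $r^b(M)=0$; 2. $M$ admits a locally flat structure. -/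

import Mathlib

open scoped Manifold ContDiff Topology

noncomputable section

namespace LocallyFlat

variable {m : ℕ} {M : Type*} [TopologicalSpace M] [ChartedSpace (EuclideanSpace ℝ (Fin m)) M]

/-- The model of an `m`-dimensional manifold without boundary. -/
abbrev model (m : ℕ) :
    ModelWithCorners ℝ (EuclideanSpace ℝ (Fin m)) (EuclideanSpace ℝ (Fin m)) :=
  𝓘(ℝ, EuclideanSpace ℝ (Fin m))

/-- (Not necessarily smooth) vector fields on `M`. -/
abbrev VField (m : ℕ) (M : Type*) [TopologicalSpace M]
    [ChartedSpace (EuclideanSpace ℝ (Fin m)) M] : Type _ :=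
  (x : M) → TangentSpace (model m) x

/-- Koszul connections on the tangent bundle of `M`; smoothness is asked for separately. -/
abbrev Connection (m : ℕ) (M : Type*) [TopologicalSpace M]
    [ChartedSpace (EuclideanSpace ℝ (Fin m)) M] [IsManifold (model m) ∞ M] : Type _ :=
  CovariantDerivative (model m) (EuclideanSpace ℝ (Fin m))
    (TangentSpace (model m) : M → Type _)

variable [IsManifold (model m) ∞ M]

/-- The vector field `X` is smooth on the set `U`. -/
def SmoothOn (X : VField m M) (U : Set M) : Prop :=
  ContMDiffOn (model m) (model m).tangent ∞
    (fun x ↦ (⟨x, X x⟩ : TangentBundle (model m) M)) U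

/-- The covariant derivative `∇_X Y`. -/
def Connection.nabla (D : Connection m M) (X Y : VField m M) : VField m M :=
  fun x ↦ D Y x (X x)

/-- `(∇²X)(Y, Z) = ∇_Y ∇_Z X - ∇_{∇_Y Z} X`. -/
def Connection.hess (D : Connection m M) (X Y Z : VField m M) : VField m M :=
  D.nabla Y (D.nabla Z X) - D.nabla (D.nabla Y Z) X

/-- `R(X, Y)Z = ∇_X ∇_Y Z - ∇_Y ∇_X Z - ∇_{[X, Y]} Z`. -/
def Connection.curv (D : Connection m M) (X Y Z : VField m M) : VField m M :=
  D.nabla X (D.nabla Y Z) - D.nabla Y (D.nabla X Z)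
    - D.nabla (VectorField.mlieBracket (model m) X Y) Z

/-- Smooth torsion-free connections. -/
structure Connection.IsSymmetric (D : Connection m M) : Prop where
  smooth : CovariantDerivative.ContMDiffCovariantDerivative D ∞
  torsion_eq_zero : D.torsion = 0

/-- Locally flat structures: smooth torsion-free connections with zero curvature. -/
structure Connection.IsLocallyFlat (D : Connection m M) : Prop extends D.IsSymmetric where
  curv_eq_zero : ∀ X Y Z : VField m M,
    SmoothOn X Set.univ → SmoothOn Y Set.univ → SmoothOn Z Set.univ → D.curv X Y Z = 0

/-- `X` is a smooth solution of `∇²X = 0` on the set `U` (used for open `U`); the values of `X`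
outside `U` are irrelevant. -/
structure Connection.IsSolutionOn (D : Connection m M) (X : VField m M) (U : Set M) : Prop where
  smooth : SmoothOn X U
  hess_eq_zero : ∀ Y Z : VField m M, SmoothOn Y Set.univ → SmoothOn Z Set.univ →
    ∀ x ∈ U, D.hess X Y Z x = 0

/-- The subspace of `T_x M` spanned by the values at `x` of the solutions of `∇²X = 0` that are
defined on some open neighbourhood of `x`. -/
def Connection.solSpan (D : Connection m M) (x : M) : Submodule ℝ (TangentSpace (model m) x) :=
  Submodule.span ℝ {v | ∃ (U : Set M) (X : VField m M),
    IsOpen U ∧ x ∈ U ∧ D.IsSolutionOn X U ∧ X x = v}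

/-- `r^b(∇)`: the minimum over `x` of the dimension of `D.solSpan x`. -/
def Connection.rb (D : Connection m M) : ℕ :=
  ⨅ x : M, Module.finrank ℝ (D.solSpan x)

/-- `r^b(∇) ≤ dim M`, so that the natural number `m - D.rb` is the honest difference. -/
theorem Connection.rb_le (D : Connection m M) : D.rb ≤ m := by
  rcases isEmpty_or_nonempty M with h | ⟨⟨x⟩⟩
  · simp [Connection.rb]
  · refine (ciInf_le (OrderBot.bddBelow _) x).trans ?_
    have : FiniteDimensional ℝ (TangentSpace (model m) x) :=
      inferInstanceAs (FiniteDimensional ℝ (EuclideanSpace ℝ (Fin m)))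
    refine (Submodule.finrank_le _).trans (le_of_eq ?_)
    exact finrank_euclideanSpace_fin (𝕜 := ℝ) (n := m)

/-- `r^b(M)`: the minimum of `dim M - r^b(∇)` over all smooth torsion-free connections. It is taken
in `ℕ∞`, where an infimum of natural numbers over a nonempty family is its (finite) minimum, and
would be `⊤`, not a junk `0`, over an empty one. -/
def rbManifold (m : ℕ) (M : Type*) [TopologicalSpace M]
    [ChartedSpace (EuclideanSpace ℝ (Fin m)) M] [IsManifold (model m) ∞ M] : ℕ∞ :=
  ⨅ D : {D : Connection m M // D.IsSymmetric}, ((m - D.1.rb : ℕ) : ℕ∞)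

end LocallyFlat

end

/-! An infimum in `ℕ∞` that equals zero is attained, so condition 1 says that some smooth
torsion-free connection has solutions of `∇²X = 0` spanning every tangent space. The theorem follows
once this is shown to be equivalent to flatness for each such connection.

Spanning implies flatness: by the Ricci identity (`Connection.curv_eq_hess_sub_hess`), the skew part
of `∇²X` in its two arguments is the curvature applied to `X`. Hence `R(Y, Z)` kills the value of
every local solution and, being tensorial, kills their span.

Flatness implies spanning: a parallel field satisfies `∇²X = 0`, so it suffices to find local
parallel fields with arbitrary value at a point. In a chart the equation is the linear system `df =
-Γ f`, whose integrability condition is the vanishing of the curvature. It is solved by integrating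
along rays from the base point and taking the value at the end point
(`exists_solution_of_flat_linear_system`). Flatness makes the first-order guess for the solution
along a neighbouring ray satisfy its ODE up to a quadratic error, and Grönwall's inequality turns
this into the required differential (`norm_radial_solution_sub_le`).

Manifold and coordinates are linked by `Connection.chartD_apply` and
`Connection.IsSymmetric.chartD_curv`. -/

set_option maxSynthPendingDepth 3

/-! ### Linear ODEs and integrability of flat linear systems -/

open Set Metric in
/-- A linear ODE with small coefficients is solvable on the unit interval. -/
theorem exists_linear_ode_solution_unitInterval {F : Type*} [NormedAddCommGroup F]
    [NormedSpace ℝ F] [CompleteSpace F] {B : ℝ → F →L[ℝ] F} (hB : ContinuousOn B (Icc 0 1))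
    {c : ℝ} (hc : ∀ t ∈ Icc (0 : ℝ) 1, ‖B t‖ ≤ c) (w : F) (hcw : c * (‖w‖ + 1) ≤ 1) :
    ∃ α : ℝ → F, α 0 = w ∧
      ∀ t ∈ Icc (0 : ℝ) 1, HasDerivWithinAt α (B t (α t)) (Icc 0 1) t := by
  have hc0 : 0 ≤ c := (norm_nonneg _).trans (hc 0 (by simp))
  -- The field has norm at most `c * (‖w‖ + 1) ≤ 1` on the unit ball around `w`, so a solution
  -- cannot leave that ball in unit time.
  have key : IsPicardLindelof (fun t x ↦ B t x) (tmin := 0) (tmax := 1) ⟨0, by simp⟩ w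
      1 0 1 ⟨c, hc0⟩ := by
    refine ⟨fun t ht ↦ ?_, fun x _ ↦ hB.clm_apply continuousOn_const, fun t ht x hx ↦ ?_, by simp⟩
    · exact ((B t).lipschitz.weaken (by exact_mod_cast hc t ht)).lipschitzOnWith
    · have hx' : ‖x‖ ≤ ‖w‖ + 1 := by
        have h1 : ‖x - w‖ ≤ 1 := by simpa [dist_eq_norm] using hx
        have h2 := norm_add_le (x - w) w
        rw [sub_add_cancel] at h2
        linarith
      calc ‖B t x‖ ≤ ‖B t‖ * ‖x‖ := (B t).le_opNorm x
        _ ≤ c * (‖w‖ + 1) := by gcongr; exact hc t ht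
        _ ≤ _ := by simpa using hcw
  exact key.exists_eq_forall_mem_Icc_hasDerivWithinAt₀

open Set Metric in
/-- Grönwall estimate for approximate solutions of a linear ODE on the unit interval. -/
theorem norm_sub_le_of_approx_linear_ode {F : Type*} [NormedAddCommGroup F]
    [NormedSpace ℝ F] {B : ℝ → F →L[ℝ] F} {c ε : ℝ} (hc : ∀ t ∈ Icc (0 : ℝ) 1, ‖B t‖ ≤ c)
    {α g g' : ℝ → F} (hα : ∀ t ∈ Icc (0 : ℝ) 1, HasDerivWithinAt α (B t (α t)) (Icc 0 1) t)
    (hg : ∀ t ∈ Icc (0 : ℝ) 1, HasDerivWithinAt g (g' t) (Icc 0 1) t)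
    (hε : ∀ t ∈ Icc (0 : ℝ) 1, ‖g' t - B t (g t)‖ ≤ ε) (h0 : α 0 = g 0) :
    ‖α 1 - g 1‖ ≤ ε * gronwallBound 0 c 1 1 := by
  have hc0 : 0 ≤ c := (norm_nonneg _).trans (hc 0 (by simp))
  have toIci {f : ℝ → F} {f' : F} {t : ℝ} (ht : t ∈ Ico (0 : ℝ) 1)
      (h : HasDerivWithinAt f f' (Icc 0 1) t) : HasDerivWithinAt f f' (Ici t) t :=
    h.mono_of_mem_nhdsWithin (Filter.mem_of_superset (Icc_mem_nhdsGE ht.2)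
      (Icc_subset_Icc ht.1 le_rfl))
  have := dist_le_of_approx_trajectories_ODE_of_mem (v := fun t x ↦ B t x) (s := fun _ ↦ univ)
    (K := ⟨c, hc0⟩) (a := 0) (b := 1) (f := α) (g := g) (f' := fun t ↦ B t (α t)) (g' := g')
    (εf := 0) (εg := ε) (δ := 0)
    (fun t ht ↦ ((B t).lipschitz.weaken
      (by exact_mod_cast hc t (Ico_subset_Icc_self ht))).lipschitzOnWith)
    (fun t ht ↦ (hα t ht).continuousWithinAt)
    (fun t ht ↦ toIci ht (hα t (Ico_subset_Icc_self ht))) (by simp) (by simp)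
    (fun t ht ↦ (hg t ht).continuousWithinAt)
    (fun t ht ↦ toIci ht (hg t (Ico_subset_Icc_self ht)))
    (fun t ht ↦ by simpa [dist_eq_norm] using hε t (Ico_subset_Icc_self ht)) (by simp)
    (by simp [h0]) 1 (by simp)
  rw [dist_eq_norm] at this
  refine this.trans (le_of_eq ?_)
  change gronwallBound 0 c (0 + ε) (1 - 0) = _
  simp only [gronwallBound]
  split_ifs
  · simp
  · simp only [zero_mul, zero_add, sub_zero]
    ring

open Set Metric in
/-- Radial solutions of a flat linear system `df = A f` depend differentiably on the end point,
with the derivative prescribed by the system: the quadratic estimate. -/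
theorem norm_radial_solution_sub_le {E F : Type*} [NormedAddCommGroup E] [NormedSpace ℝ E]
    [NormedAddCommGroup F] [NormedSpace ℝ F] {A : E → E →L[ℝ] F →L[ℝ] F} {y₀ : E} {r : ℝ}
    {C C' L N : ℝ} (hA : ∀ y ∈ ball y₀ r, DifferentiableAt ℝ A y)
    (hC : ∀ y ∈ ball y₀ r, ‖A y‖ ≤ C) (hC' : ∀ y ∈ ball y₀ r, ‖fderiv ℝ A y‖ ≤ C')
    (hL : ∀ y ∈ ball y₀ r, ∀ z ∈ ball y₀ r, ‖A z - A y - fderiv ℝ A y (z - y)‖ ≤ L * ‖z - y‖ ^ 2)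
    (hflat : ∀ y ∈ ball y₀ r, ∀ u v : E, ∀ w : F,
      fderiv ℝ A y u v w + A y v (A y u w) = fderiv ℝ A y v u w + A y u (A y v w))
    {y z : E} (hy : y ∈ ball y₀ r) (hz : z ∈ ball y₀ r) {α β : ℝ → F} (h0 : α 0 = β 0)
    (hα : ∀ t ∈ Icc (0 : ℝ) 1,
      HasDerivWithinAt α (A (y₀ + t • (y - y₀)) (y - y₀) (α t)) (Icc 0 1) t)
    (hβ : ∀ t ∈ Icc (0 : ℝ) 1,
      HasDerivWithinAt β (A (y₀ + t • (z - y₀)) (z - y₀) (β t)) (Icc 0 1) t)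
    (hN : ∀ t ∈ Icc (0 : ℝ) 1, ‖α t‖ ≤ N) :
    ‖β 1 - α 1 - A y (z - y) (α 1)‖ ≤
      (C * C * N + C' * (N + C * (2 * r) * N) + C' * r * (C * N) +
        L * r * (N + C * (2 * r) * N)) * gronwallBound 0 (C * r) 1 1 * ‖z - y‖ ^ 2 := by
  have hr : 0 < r := pos_of_mem_ball hy
  have hy₀ : y₀ ∈ ball y₀ r := mem_ball_self hr
  have hC0 : 0 ≤ C := (norm_nonneg _).trans (hC _ hy₀)
  have hC'0 : 0 ≤ C' := (norm_nonneg _).trans (hC' _ hy₀)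
  have hN0 : 0 ≤ N := (norm_nonneg _).trans (hN 0 (by simp))
  set x := y - y₀ with hx
  set h := z - y with hh
  have hzx : z - y₀ = x + h := by rw [hx, hh]; abel
  have hxr : ‖x‖ ≤ r := (mem_ball_iff_norm.1 hy).le
  have hxhr : ‖x + h‖ ≤ r := by rw [← hzx]; exact (mem_ball_iff_norm.1 hz).le
  have hhr : ‖h‖ ≤ 2 * r := by
    have := norm_sub_le (x + h) x
    rw [add_sub_cancel_left] at this
    linarith
  rw [hzx] at hβ
  have hseg {u : E} (hu : y₀ + u ∈ ball y₀ r) {t : ℝ} (ht : t ∈ Icc (0 : ℝ) 1) :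
      y₀ + t • u ∈ ball y₀ r := by
    simp only [mem_ball_iff_norm, add_sub_cancel_left] at hu ⊢
    rw [norm_smul, Real.norm_of_nonneg ht.1]
    exact (mul_le_of_le_one_left (norm_nonneg _) ht.2).trans_lt hu
  have hxmem {t : ℝ} (ht : t ∈ Icc (0 : ℝ) 1) : y₀ + t • x ∈ ball y₀ r :=
    hseg (by rw [hx]; simpa using hy) ht
  have hxhmem {t : ℝ} (ht : t ∈ Icc (0 : ℝ) 1) : y₀ + t • (x + h) ∈ ball y₀ r :=
    hseg (by rw [← hzx]; simpa using hz) ht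
  set a : ℝ → E →L[ℝ] F →L[ℝ] F := fun t ↦ A (y₀ + t • x) with ha
  set a' : ℝ → E →L[ℝ] E →L[ℝ] F →L[ℝ] F := fun t ↦ fderiv ℝ A (y₀ + t • x) with ha'
  have hL0 : 0 ≤ L * ‖h‖ ^ 2 := (norm_nonneg _).trans (hL y hy z hz)
  have hderiv_a (t : ℝ) (ht : t ∈ Icc (0 : ℝ) 1) : HasDerivAt a (a' t x) t := by
    have h1 : HasDerivAt (fun t : ℝ ↦ y₀ + t • x) x t := by
      simpa using ((hasDerivAt_id t).smul_const x).const_add y₀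
    exact (hA _ (hxmem ht)).hasFDerivAt.comp_hasDerivAt t h1
  -- First-order prediction for `β`: if `f` solved `df = A f`, moving from `y₀ + t • x` by `t • h`
  -- would change `f` by about `t • A h f`.
  set g : ℝ → F := fun t ↦ α t + t • a t h (α t) with hgdef
  have hg (t : ℝ) (ht : t ∈ Icc (0 : ℝ) 1) :
      HasDerivWithinAt g (a t x (α t) + (t • (a' t x h (α t) + a t h (a t x (α t))) +
        a t h (α t))) (Icc 0 1) t := by
    have h1 : HasDerivWithinAt (fun t ↦ a t h) (a' t x h) (Icc 0 1) t :=
      ((hderiv_a t ht).clm_apply (hasDerivAt_const t h)).hasDerivWithinAt.congr_deriv (by simp)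
    have h2 := h1.clm_apply (hα t ht)
    have h3 := (hα t ht).add ((hasDerivWithinAt_id t (Icc 0 1)).smul h2)
    exact h3.congr_deriv (by simp [ha])
  have hat (t : ℝ) (ht : t ∈ Icc (0 : ℝ) 1) (u : E) (v : F) : ‖a t u v‖ ≤ C * ‖u‖ * ‖v‖ :=
    ((a t).le_opNorm₂ u v).trans (by gcongr; exact hC _ (hxmem ht))
  have ha't (t : ℝ) (ht : t ∈ Icc (0 : ℝ) 1) (u u' : E) (v : F) :
      ‖a' t u u' v‖ ≤ C' * ‖u‖ * ‖u'‖ * ‖v‖ := by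
    refine ((a' t u).le_opNorm₂ u' v).trans ?_
    gcongr
    exact ((a' t).le_opNorm u).trans (by gcongr; exact hC' _ (hxmem ht))
  have hgN (t : ℝ) (ht : t ∈ Icc (0 : ℝ) 1) : ‖g t‖ ≤ N + C * (2 * r) * N := by
    refine (norm_add_le _ _).trans (add_le_add (hN t ht) ?_)
    rw [norm_smul, Real.norm_of_nonneg ht.1]
    refine (mul_le_of_le_one_left (norm_nonneg _) ht.2).trans ((hat t ht h (α t)).trans ?_)
    gcongr
    exact hN t ht
  have hR (t : ℝ) (ht : t ∈ Icc (0 : ℝ) 1) :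
      ‖A (y₀ + t • (x + h)) - a t - t • a' t h‖ ≤ L * ‖h‖ ^ 2 := by
    have h1 := hL _ (hxmem ht) _ (hxhmem ht)
    have h2 : y₀ + t • (x + h) - (y₀ + t • x) = t • h := by rw [smul_add]; abel
    rw [h2, map_smul, norm_smul, Real.norm_of_nonneg ht.1] at h1
    refine h1.trans ?_
    have h3 : t ^ 2 ≤ 1 := pow_le_one₀ ht.1 ht.2
    calc L * (t * ‖h‖) ^ 2 = t ^ 2 * (L * ‖h‖ ^ 2) := by ring
      _ ≤ L * ‖h‖ ^ 2 := mul_le_of_le_one_left hL0 h3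
  have hbound (t : ℝ) (ht : t ∈ Icc (0 : ℝ) 1) :
      ‖(a t x (α t) + (t • (a' t x h (α t) + a t h (a t x (α t))) + a t h (α t))) -
        A (y₀ + t • (x + h)) (x + h) (g t)‖ ≤ (C * C * N + C' * (N + C * (2 * r) * N) +
          C' * r * (C * N) + L * r * (N + C * (2 * r) * N)) * ‖h‖ ^ 2 := by
    set R := A (y₀ + t • (x + h)) - a t - t • a' t h with hRdef
    have hAR : A (y₀ + t • (x + h)) = a t + t • a' t h + R := by rw [hRdef]; abel
    -- Flatness exchanges `x` and `h` in `a' t x h (α t) + a t h (a t x (α t))`. Then all terms of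
    -- order at most one in `h` cancel; the four remaining terms are quadratic, the last because `R`
    -- is a Taylor remainder.
    have hid : (a t x (α t) + (t • (a' t x h (α t) + a t h (a t x (α t))) + a t h (α t))) -
        A (y₀ + t • (x + h)) (x + h) (g t) =
        -(t • a t h (a t h (α t)) + t • a' t h h (g t) + (t * t) • a' t h x (a t h (α t)) +
          R (x + h) (g t)) := by
      rw [hflat _ (hxmem ht) x h (α t), hAR]
      simp only [hgdef, map_add, map_smul, add_apply,
        smul_apply, smul_add, smul_smul, ha, ha']
      module
    rw [hid, norm_neg]
    have ht1 (v : F) : ‖t • v‖ ≤ ‖v‖ := by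
      rw [norm_smul, Real.norm_of_nonneg ht.1]
      exact mul_le_of_le_one_left (norm_nonneg _) ht.2
    have e1 : ‖t • a t h (a t h (α t))‖ ≤ C * C * N * ‖h‖ ^ 2 :=
      calc _ ≤ ‖a t h (a t h (α t))‖ := ht1 _
        _ ≤ C * ‖h‖ * (C * ‖h‖ * N) := by
          refine (hat t ht _ _).trans ?_
          gcongr
          refine (hat t ht _ _).trans ?_
          gcongr
          exact hN t ht
        _ = _ := by ring
    have e2 : ‖t • a' t h h (g t)‖ ≤ C' * (N + C * (2 * r) * N) * ‖h‖ ^ 2 :=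
      calc _ ≤ ‖a' t h h (g t)‖ := ht1 _
        _ ≤ C' * ‖h‖ * ‖h‖ * (N + C * (2 * r) * N) := by
          refine (ha't t ht _ _ _).trans ?_
          gcongr
          exact hgN t ht
        _ = _ := by ring
    have e3 : ‖(t * t) • a' t h x (a t h (α t))‖ ≤ C' * r * (C * N) * ‖h‖ ^ 2 :=
      calc _ ≤ ‖a' t h x (a t h (α t))‖ := by rw [← smul_smul]; exact (ht1 _).trans (ht1 _)
        _ ≤ C' * ‖h‖ * r * (C * ‖h‖ * N) := by
          refine (ha't t ht _ _ _).trans ?_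
          gcongr
          refine (hat t ht _ _).trans ?_
          gcongr
          exact hN t ht
        _ = _ := by ring
    have e4 : ‖R (x + h) (g t)‖ ≤ L * r * (N + C * (2 * r) * N) * ‖h‖ ^ 2 :=
      calc _ ≤ ‖R‖ * ‖x + h‖ * ‖g t‖ := R.le_opNorm₂ _ _
        _ ≤ L * ‖h‖ ^ 2 * r * (N + C * (2 * r) * N) := by
          gcongr
          · exact hR t ht
          · exact hgN t ht
        _ = _ := by ring
    refine (norm_add_le _ _).trans ?_
    have h12 := norm_add_le (t • a t h (a t h (α t)) + t • a' t h h (g t))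
      ((t * t) • a' t h x (a t h (α t)))
    have h11 := norm_add_le (t • a t h (a t h (α t))) (t • a' t h h (g t))
    linarith
  have hBc (t : ℝ) (ht : t ∈ Icc (0 : ℝ) 1) : ‖A (y₀ + t • (x + h)) (x + h)‖ ≤ C * r :=
    (ContinuousLinearMap.le_opNorm _ _).trans (by gcongr; exact hC _ (hxhmem ht))
  have hfin := norm_sub_le_of_approx_linear_ode (B := fun t ↦ A (y₀ + t • (x + h)) (x + h))
    hBc hβ hg hbound (by simp [hgdef, h0])
  have h1 : g 1 = α 1 + A y h (α 1) := by simp [hgdef, ha, hx]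
  rw [h1, ← sub_sub] at hfin
  refine hfin.trans (le_of_eq ?_)
  ring

open Set Metric in
/-- Solutions of a linear system `df = A f` with smooth coefficients are smooth. -/
theorem contDiffOn_of_hasFDerivAt_linear_system {E F : Type*} [NormedAddCommGroup E]
    [NormedSpace ℝ E] [NormedAddCommGroup F] [NormedSpace ℝ F] {A : E → E →L[ℝ] F →L[ℝ] F}
    {s : Set E} (hs : IsOpen s) (hA : ContDiffOn ℝ ∞ A s) {f : E → F}
    (hf : ∀ y ∈ s, HasFDerivAt f ((A y).flip (f y)) y) : ContDiffOn ℝ ∞ f s := by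
  rw [contDiffOn_infty]
  intro n
  induction n with
  | zero =>
    exact contDiffOn_zero.2 fun y hy ↦ (hf y hy).continuousAt.continuousWithinAt
  | succ n ih =>
    rw [Nat.cast_succ, contDiffOn_succ_iff_fderiv_of_isOpen hs]
    refine ⟨fun y hy ↦ (hf y hy).differentiableAt.differentiableWithinAt, by simp, ?_⟩
    -- Bootstrapping: the equation makes the derivative of `f` as regular as `f` itself.
    have h1 : ContDiffOn ℝ n (fun y ↦ (A y).flip (f y)) s := by
      have h2 : ContDiffOn ℝ n (fun y ↦ (A y).flip) s :=
        (ContinuousLinearMap.flipₗᵢ ℝ E F F).contDiff.comp_contDiffOn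
          (hA.of_le (mod_cast le_top))
      exact h2.clm_apply ih
    exact h1.congr fun y hy ↦ (hf y hy).fderiv

open Set Metric in
/-- A flat linear system `df = A f` has a local solution with any prescribed initial value. -/
theorem exists_solution_of_flat_linear_system {E F : Type*} [NormedAddCommGroup E]
    [NormedSpace ℝ E] [NormedAddCommGroup F] [NormedSpace ℝ F] [CompleteSpace F]
    {A : E → E →L[ℝ] F →L[ℝ] F} {s : Set E} (hs : IsOpen s) (hA : ContDiffOn ℝ ∞ A s)
    (hflat : ∀ y ∈ s, ∀ u v : E, ∀ w : F,
      fderiv ℝ A y u v w + A y v (A y u w) = fderiv ℝ A y v u w + A y u (A y v w))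
    {y₀ : E} (hy₀ : y₀ ∈ s) (w : F) :
    ∃ (t : Set E) (f : E → F), IsOpen t ∧ y₀ ∈ t ∧ t ⊆ s ∧ f y₀ = w ∧ ContDiffOn ℝ ∞ f t ∧
      ∀ y ∈ t, HasFDerivAt f ((A y).flip (f y)) y := by
  have hAt : ContDiffAt ℝ ∞ A y₀ := hA.contDiffAt (hs.mem_nhds hy₀)
  have hA't : ContDiffAt ℝ 1 (fderiv ℝ A) y₀ := hAt.fderiv_right (m := 1) (by norm_cast)
  obtain ⟨L, t, ht, hLt⟩ := hA't.exists_lipschitzOnWith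
  set C := ‖A y₀‖ + 1 with hCdef
  set C' := ‖fderiv ℝ A y₀‖ + 1 with hC'def
  have hCev : ∀ᶠ y in 𝓝 y₀, ‖A y‖ < C :=
    hAt.continuousAt.norm.eventually_lt continuousAt_const (by simp [hCdef])
  have hC'ev : ∀ᶠ y in 𝓝 y₀, ‖fderiv ℝ A y‖ < C' :=
    hA't.continuousAt.norm.eventually_lt continuousAt_const (by simp [hC'def])
  obtain ⟨r₀, hr₀, hball⟩ := Metric.mem_nhds_iff.1
    (Filter.inter_mem (Filter.inter_mem (hs.mem_nhds hy₀) ht) (Filter.inter_mem hCev hC'ev))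
  have hCpos : 0 < C := by positivity
  -- The second bound makes the coefficient `C * r` of the radial ODE small enough for unit-time
  -- existence.
  set r := min r₀ (1 / (C * (‖w‖ + 1))) with hrdef
  have hr : 0 < r := lt_min hr₀ (by positivity)
  have hrr₀ : ball y₀ r ⊆ ball y₀ r₀ := ball_subset_ball (min_le_left _ _)
  have hrw : C * r * (‖w‖ + 1) ≤ 1 := by
    have : r ≤ 1 / (C * (‖w‖ + 1)) := min_le_right _ _
    rw [le_div_iff₀ (by positivity)] at this
    linarith
  have hsub : ball y₀ r ⊆ s := fun y hy ↦ (hball (hrr₀ hy)).1.1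
  have hC : ∀ y ∈ ball y₀ r, ‖A y‖ ≤ C := fun y hy ↦ le_of_lt (hball (hrr₀ hy)).2.1
  have hC' : ∀ y ∈ ball y₀ r, ‖fderiv ℝ A y‖ ≤ C' := fun y hy ↦ le_of_lt (hball (hrr₀ hy)).2.2
  have hdiff : ∀ y ∈ ball y₀ r, DifferentiableAt ℝ A y := fun y hy ↦
    (hA.contDiffAt (hs.mem_nhds (hsub hy))).differentiableAt (by simp)
  -- A Lipschitz derivative gives a quadratic Taylor remainder, by the mean value inequality on the
  -- segment.
  have hL : ∀ y ∈ ball y₀ r, ∀ z ∈ ball y₀ r,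
      ‖A z - A y - fderiv ℝ A y (z - y)‖ ≤ L * ‖z - y‖ ^ 2 := by
    intro y hy z hz
    have hsegsub : segment ℝ y z ⊆ ball y₀ r := (convex_ball y₀ r).segment_subset hy hz
    have := (convex_segment y z).norm_image_sub_le_of_norm_hasFDerivWithin_le'
      (C := L * ‖z - y‖) (φ := fderiv ℝ A y) (f := A)
      (fun p hp ↦ (hdiff p (hsegsub hp)).hasFDerivAt.hasFDerivWithinAt) (fun p hp ↦ by
        have h1 := hLt.dist_le_mul p (hball (hrr₀ (hsegsub hp))).1.2 y (hball (hrr₀ hy)).1.2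
        rw [dist_eq_norm, dist_eq_norm] at h1
        refine h1.trans ?_
        gcongr
        rw [← dist_eq_norm, ← dist_eq_norm, dist_comm p, dist_comm z]
        have := dist_add_dist_of_mem_segment hp
        linarith [dist_nonneg (x := p) (y := z)])
      (left_mem_segment ℝ y z) (right_mem_segment ℝ y z)
    calc _ ≤ L * ‖z - y‖ * ‖z - y‖ := this
      _ = _ := by ring
  have hex : ∀ y : E, ∃ α : ℝ → F, y ∈ ball y₀ r → α 0 = w ∧ ∀ t ∈ Icc (0 : ℝ) 1,
      HasDerivWithinAt α (A (y₀ + t • (y - y₀)) (y - y₀) (α t)) (Icc 0 1) t := by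
    intro y
    by_cases hy : y ∈ ball y₀ r
    · have hmem : ∀ t ∈ Icc (0 : ℝ) 1, y₀ + t • (y - y₀) ∈ ball y₀ r := fun t ht ↦
        (convex_ball y₀ r).add_smul_sub_mem (mem_ball_self hr) hy ht
      obtain ⟨α, hα0, hα⟩ := exists_linear_ode_solution_unitInterval
        (B := fun t ↦ A (y₀ + t • (y - y₀)) (y - y₀)) (c := C * r) (by
          refine ContinuousOn.clm_apply (ContinuousOn.comp (t := ball y₀ r) ?_ ?_ hmem)
            continuousOn_const
          · exact fun y hy ↦ (hdiff y hy).continuousAt.continuousWithinAt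
          · fun_prop) (fun t ht ↦ (ContinuousLinearMap.le_opNorm _ _).trans (by
            gcongr
            · exact hC _ (hmem t ht)
            · exact (mem_ball_iff_norm.1 hy).le)) w hrw
      exact ⟨α, fun _ ↦ ⟨hα0, hα⟩⟩
    · exact ⟨0, fun h ↦ absurd h hy⟩
  choose α hα using hex
  -- The candidate solution sends `y` to the time-one value of the ODE along the ray from `y₀` to
  -- `y`.
  have hsol : ∀ y ∈ ball y₀ r, HasFDerivAt (fun y ↦ α y 1) ((A y).flip (α y 1)) y := by
    intro y hy
    obtain ⟨N, hN⟩ := isCompact_Icc.exists_bound_of_continuousOn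
      (fun t ht ↦ ((hα y hy).2 t ht).continuousWithinAt)
    have hO : (fun z ↦ α z 1 - α y 1 - A y (z - y) (α y 1)) =O[𝓝 y] fun z ↦ ‖z - y‖ ^ 2 := by
      obtain ⟨K, hK⟩ : ∃ K : ℝ, ∀ z ∈ ball y₀ r,
          ‖α z 1 - α y 1 - A y (z - y) (α y 1)‖ ≤ K * ‖z - y‖ ^ 2 :=
        ⟨_, fun z hz ↦ norm_radial_solution_sub_le hdiff hC hC' hL
          (fun p hp ↦ hflat p (hsub hp)) hy hz ((hα y hy).1.trans (hα z hz).1.symm) (hα y hy).2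
          (hα z hz).2 hN⟩
      refine Asymptotics.IsBigO.of_bound K (Filter.eventually_of_mem (isOpen_ball.mem_nhds hy)
        fun z hz ↦ (hK z hz).trans (le_of_eq ?_))
      rw [norm_pow, norm_norm]
    have h1 : HasFDerivAt (fun z ↦ α z 1 - α y 1 - A y (z - y) (α y 1)) 0 y :=
      hO.hasFDerivAt (𝕜 := ℝ) one_lt_two
    have h2 : HasFDerivAt (fun z ↦ (A y).flip (α y 1) (z - y)) ((A y).flip (α y 1)) y := by
      exact ((A y).flip (α y 1)).hasFDerivAt.comp y ((hasFDerivAt_id y).sub_const y)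
    have h3 := (h1.add h2).add_const (α y 1)
    rw [zero_add] at h3
    exact h3.congr_of_eventuallyEq (Filter.Eventually.of_forall fun z ↦ by
      simp [ContinuousLinearMap.flip_apply])
  refine ⟨ball y₀ r, fun y ↦ α y 1, isOpen_ball, mem_ball_self hr, hsub, ?_,
    contDiffOn_of_hasFDerivAt_linear_system isOpen_ball (hA.mono hsub) hsol, hsol⟩
  -- Over `y₀` the ray is constant and the ODE is `α' = 0`; Grönwall with zero constants gives `α 1
  -- = w`.
  obtain ⟨h0, hd⟩ := hα y₀ (mem_ball_self hr)
  have := norm_sub_le_of_approx_linear_ode (B := fun _ ↦ (0 : F →L[ℝ] F)) (c := 0) (ε := 0)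
    (g := fun _ ↦ w) (g' := 0) (α := α y₀) (by simp) (fun t ht ↦ by simpa using hd t ht)
    (fun t _ ↦ hasDerivWithinAt_const _ _ _) (by simp) h0
  simpa [sub_eq_zero] using this

noncomputable section

namespace LocallyFlat

section Charts

/-! ### Connections and curvature in a vector space -/

section Calculus

variable {E : Type*} [NormedAddCommGroup E] [NormedSpace ℝ E]

/-- The covariant derivative of `Y` along `X` in a vector space, with Christoffel symbols `Γ`. -/
def coordNabla (Γ : E → E →L[ℝ] E →L[ℝ] E) (X Y : E → E) : E → E :=
  fun y ↦ fderiv ℝ Y y (X y) + Γ y (X y) (Y y)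

/-- The curvature tensor in a vector space, with Christoffel symbols `Γ`. -/
def coordCurv (Γ : E → E →L[ℝ] E →L[ℝ] E) (y u v w : E) : E :=
  fderiv ℝ Γ y u v w - fderiv ℝ Γ y v u w + Γ y u (Γ y v w) - Γ y v (Γ y u w)

theorem fderiv_coordNabla {Γ : E → E →L[ℝ] E →L[ℝ] E} {X Y : E → E} {y : E}
    (hΓ : ContDiffAt ℝ ∞ Γ y) (hX : ContDiffAt ℝ ∞ X y) (hY : ContDiffAt ℝ ∞ Y y) (u : E) :
    fderiv ℝ (coordNabla Γ X Y) y u =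
      fderiv ℝ (fderiv ℝ Y) y u (X y) + fderiv ℝ Y y (fderiv ℝ X y u) +
        (fderiv ℝ Γ y u (X y) (Y y) + Γ y (fderiv ℝ X y u) (Y y) +
          Γ y (X y) (fderiv ℝ Y y u)) := by
  have hΓ' := (hΓ.differentiableAt (by simp)).hasFDerivAt
  have hX' := (hX.differentiableAt (by simp)).hasFDerivAt
  have hY' := (hY.differentiableAt (by simp)).hasFDerivAt
  have hY'' := ((hY.fderiv_right (m := 1) (by norm_cast)).differentiableAt (by simp)).hasFDerivAt
  have h := (hY''.clm_apply hX').add ((hΓ'.clm_apply hX').clm_apply hY')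
  have h' : fderiv ℝ (coordNabla Γ X Y) y = _ := h.fderiv
  rw [h']
  simp
  abel

/-- The Ricci identity defining the curvature, in a vector space. -/
theorem coordNabla_commutator {Γ : E → E →L[ℝ] E →L[ℝ] E} {X Y Z : E → E} {y : E}
    (hΓ : ContDiffAt ℝ ∞ Γ y) (hsymm : ∀ u v, Γ y u v = Γ y v u) (hX : ContDiffAt ℝ ∞ X y)
    (hY : ContDiffAt ℝ ∞ Y y) (hZ : ContDiffAt ℝ ∞ Z y) :
    coordNabla Γ X (coordNabla Γ Y Z) y - coordNabla Γ Y (coordNabla Γ X Z) y -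
      (fderiv ℝ Z y (coordNabla Γ X Y y - coordNabla Γ Y X y) +
        Γ y (coordNabla Γ X Y y - coordNabla Γ Y X y) (Z y)) =
      coordCurv Γ y (X y) (Y y) (Z y) := by
  -- The difference of covariant derivatives stands for `[X, Y]`, as `Γ` is symmetric. What remains
  -- is the symmetry of second derivatives of `Z`.
  have hZs : fderiv ℝ (fderiv ℝ Z) y (X y) (Y y) = fderiv ℝ (fderiv ℝ Z) y (Y y) (X y) :=
    (hZ.isSymmSndFDerivAt (by simp; norm_cast)).eq _ _
  rw [coordNabla, fderiv_coordNabla hΓ hY hZ, coordNabla.eq_def Γ Y (coordNabla Γ X Z),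
    fderiv_coordNabla hΓ hX hZ, hZs]
  simp only [coordNabla, coordCurv, hsymm (Y y) (X y), map_add, map_sub, add_sub_add_right_eq_sub,
    sub_apply]
  abel

end Calculus

/-! ### Vector fields read in a chart -/

variable {m : ℕ} {M : Type*} [TopologicalSpace M] [ChartedSpace (EuclideanSpace ℝ (Fin m)) M]

/-- The derivative of the chart at `x₀`, as a map into the model space. -/
def chartD (m : ℕ) {M : Type*} [TopologicalSpace M]
    [ChartedSpace (EuclideanSpace ℝ (Fin m)) M] (x₀ p : M) : TangentSpace (model m) p →L[ℝ] EuclideanSpace ℝ (Fin m) :=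
  mfderiv (model m) (model m) (extChartAt (model m) x₀) p

/-- The expression of a vector field in the chart at `x₀`. -/
def coords (x₀ : M) (X : VField m M) : EuclideanSpace ℝ (Fin m) → EuclideanSpace ℝ (Fin m) :=
  fun y ↦ chartD m x₀ ((extChartAt (model m) x₀).symm y) (X ((extChartAt (model m) x₀).symm y))

/-- The vector field with a given expression in the chart at `x₀`. -/
def ofCoords (x₀ : M) (f : EuclideanSpace ℝ (Fin m) → EuclideanSpace ℝ (Fin m)) : VField m M :=
  VectorField.mpullback (model m) (model m) (extChartAt (model m) x₀) f

variable {x₀ p : M}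

theorem ofCoords_apply (f : EuclideanSpace ℝ (Fin m) → EuclideanSpace ℝ (Fin m)) :
    ofCoords x₀ f p = (chartD m x₀ p).inverse (f (extChartAt (model m) x₀ p)) := rfl

theorem coords_extChartAt (hp : p ∈ (chartAt (EuclideanSpace ℝ (Fin m)) x₀).source)
    (X : VField m M) : coords x₀ X (extChartAt (model m) x₀ p) = chartD m x₀ p (X p) := by
  rw [coords, (extChartAt (model m) x₀).left_inv (by simpa using hp)]

/-- A property that holds near `p` holds, read in the chart, near the image of `p`. -/
theorem eventually_extChartAt_symm (hp : p ∈ (chartAt (EuclideanSpace ℝ (Fin m)) x₀).source)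
    {P : EuclideanSpace ℝ (Fin m) → Prop}
    (h : ∀ᶠ q in 𝓝 p, P (extChartAt (model m) x₀ q)) :
    ∀ᶠ y in 𝓝 (extChartAt (model m) x₀ p), P y := by
  have hp' : p ∈ (extChartAt (model m) x₀).source := by simpa using hp
  have hc : ContinuousAt (extChartAt (model m) x₀).symm (extChartAt (model m) x₀ p) :=
    continuousAt_extChartAt_symm' hp'
  have h1 : ∀ᶠ y in 𝓝 (extChartAt (model m) x₀ p), y ∈ (extChartAt (model m) x₀).target :=
    extChartAt_target_mem_nhds' ((extChartAt (model m) x₀).map_source hp')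
  have h2 := hc.tendsto.eventually (by rwa [(extChartAt (model m) x₀).left_inv hp'])
  filter_upwards [h1, h2] with y hy hPy
  rwa [(extChartAt (model m) x₀).right_inv hy] at hPy

theorem source_mem_nhds (hp : p ∈ (chartAt (EuclideanSpace ℝ (Fin m)) x₀).source) :
    (chartAt (EuclideanSpace ℝ (Fin m)) x₀).source ∈ 𝓝 p :=
  (chartAt (EuclideanSpace ℝ (Fin m)) x₀).open_source.mem_nhds hp

variable [IsManifold (model m) ∞ M]

theorem isInvertible_chartD (hp : p ∈ (chartAt (EuclideanSpace ℝ (Fin m)) x₀).source) :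
    (chartD m x₀ p).IsInvertible :=
  isInvertible_mfderiv_extChartAt (by simpa using hp)

theorem chartD_inverse_apply (hp : p ∈ (chartAt (EuclideanSpace ℝ (Fin m)) x₀).source)
    (w : EuclideanSpace ℝ (Fin m)) : chartD m x₀ p ((chartD m x₀ p).inverse w) = w :=
  (isInvertible_chartD hp).self_apply_inverse w

theorem inverse_chartD_apply (hp : p ∈ (chartAt (EuclideanSpace ℝ (Fin m)) x₀).source)
    (v : TangentSpace (model m) p) : (chartD m x₀ p).inverse (chartD m x₀ p v) = v :=
  (isInvertible_chartD hp).inverse_apply_self v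

theorem chartD_injective (hp : p ∈ (chartAt (EuclideanSpace ℝ (Fin m)) x₀).source) :
    Function.Injective (chartD m x₀ p) := (isInvertible_chartD hp).injective

theorem coords_ofCoords (hp : p ∈ (chartAt (EuclideanSpace ℝ (Fin m)) x₀).source)
    (f : EuclideanSpace ℝ (Fin m) → EuclideanSpace ℝ (Fin m)) :
    coords x₀ (ofCoords x₀ f) (extChartAt (model m) x₀ p) = f (extChartAt (model m) x₀ p) := by
  rw [coords_extChartAt hp, ofCoords_apply, chartD_inverse_apply hp]

/-- Regularity of sections is phrased through bundle trivializations; this transfers it to chart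
components. -/
theorem trivializationAt_snd_eq_chartD
    (hp : p ∈ (chartAt (EuclideanSpace ℝ (Fin m)) x₀).source) (v : TangentSpace (model m) p) :
    (trivializationAt (EuclideanSpace ℝ (Fin m)) (TangentSpace (model m)) x₀
      (⟨p, v⟩ : TangentBundle (model m) M)).2 = chartD m x₀ p v := by
  have h := TangentBundle.continuousLinearMapAt_trivializationAt (I := model m) (𝕜 := ℝ) hp
  have h' := DFunLike.congr_fun h v
  rw [Bundle.Trivialization.continuousLinearMapAt_apply,
    Bundle.Trivialization.coe_linearMapAt_of_mem _ (by simpa using hp)] at h'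
  exact h'

theorem contMDiffAt_chartD_apply (hp : p ∈ (chartAt (EuclideanSpace ℝ (Fin m)) x₀).source)
    {X : VField m M} {n : ℕ∞ω} [IsManifold (model m) (n + 1) M]
    (hX : ContMDiffAt (model m) (model m).tangent n
      (fun x ↦ (⟨x, X x⟩ : TangentBundle (model m) M)) p) :
    ContMDiffAt (model m) (model m) n (fun q ↦ chartD m x₀ q (X q)) p := by
  have := TangentBundle.contMDiffVectorBundle (I := model m) (M := M) (n := n)
  have h := ((trivializationAt (EuclideanSpace ℝ (Fin m)) (TangentSpace (model m))
    x₀).contMDiffAt_section_iff (IB := model m) (n := n) (s := X) (x₀ := p) (by simpa using hp)).1 hX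
  refine h.congr_of_eventuallyEq ?_
  filter_upwards [source_mem_nhds hp] with q hq
  exact (trivializationAt_snd_eq_chartD hq _).symm

end Charts

/-! ### Regularity of coordinate expressions and Christoffel symbols -/

section Fields

variable {m : ℕ} {M : Type*} [TopologicalSpace M] [ChartedSpace (EuclideanSpace ℝ (Fin m)) M]
  [IsManifold (model m) ∞ M] {x₀ p : M}

theorem mdifferentiableAt_chartD_apply (hp : p ∈ (chartAt (EuclideanSpace ℝ (Fin m)) x₀).source)
    {X : VField m M} (hX : MDifferentiableAt (model m) (model m).tangent
      (fun x ↦ (⟨x, X x⟩ : TangentBundle (model m) M)) p) :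
    MDifferentiableAt (model m) (model m) (fun q ↦ chartD m x₀ q (X q)) p := by
  have h := ((trivializationAt (EuclideanSpace ℝ (Fin m)) (TangentSpace (model m))
    x₀).mdifferentiableAt_section_iff (model m) X (b₀ := p) (by simpa using hp)).1 hX
  refine h.congr_of_eventuallyEq ?_
  filter_upwards [source_mem_nhds hp] with q hq
  exact (trivializationAt_snd_eq_chartD hq _).symm

theorem contDiffAt_coords (hp : p ∈ (chartAt (EuclideanSpace ℝ (Fin m)) x₀).source)
    {X : VField m M} (hX : ContMDiffAt (model m) (model m).tangent ∞
      (fun x ↦ (⟨x, X x⟩ : TangentBundle (model m) M)) p) :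
    ContDiffAt ℝ ∞ (coords x₀ X) (extChartAt (model m) x₀ p) := by
  have hp' : p ∈ (extChartAt (model m) x₀).source := by simpa using hp
  have : IsManifold (model m) (∞ + 1) M := ‹IsManifold (model m) ∞ M›
  have h := contMDiffAt_chartD_apply hp hX
  have hs : ContMDiffAt (model m) (model m) ∞ (extChartAt (model m) x₀).symm
      (extChartAt (model m) x₀ p) :=
    (contMDiffOn_extChartAt_symm (I := model m) x₀).contMDiffAt
      (extChartAt_target_mem_nhds' ((extChartAt (model m) x₀).map_source hp'))
  rw [← (extChartAt (model m) x₀).left_inv hp'] at h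
  exact (h.comp _ hs).contDiffAt

theorem differentiableAt_coords (hp : p ∈ (chartAt (EuclideanSpace ℝ (Fin m)) x₀).source)
    {X : VField m M} (hX : MDifferentiableAt (model m) (model m).tangent
      (fun x ↦ (⟨x, X x⟩ : TangentBundle (model m) M)) p) :
    DifferentiableAt ℝ (coords x₀ X) (extChartAt (model m) x₀ p) := by
  have hp' : p ∈ (extChartAt (model m) x₀).source := by simpa using hp
  have h := mdifferentiableAt_chartD_apply hp hX
  have hs : MDifferentiableAt (model m) (model m) (extChartAt (model m) x₀).symm
      (extChartAt (model m) x₀ p) :=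
    ((contMDiffOn_extChartAt_symm (I := model m) (n := ∞) x₀).contMDiffAt
      (extChartAt_target_mem_nhds'
        ((extChartAt (model m) x₀).map_source hp'))).mdifferentiableAt (by simp)
  rw [← (extChartAt (model m) x₀).left_inv hp'] at h
  exact (h.comp _ hs).differentiableAt

theorem contMDiffAt_ofCoords (hp : p ∈ (chartAt (EuclideanSpace ℝ (Fin m)) x₀).source)
    {f : EuclideanSpace ℝ (Fin m) → EuclideanSpace ℝ (Fin m)}
    (hf : ContDiffAt ℝ ∞ f (extChartAt (model m) x₀ p)) :
    ContMDiffAt (model m) (model m).tangent ∞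
      (fun x ↦ (⟨x, ofCoords x₀ f x⟩ : TangentBundle (model m) M)) p :=
  ContMDiffAt.mpullback_vectorField_preimage (n := ∞)
    (contMDiffAt_vectorSpace_iff_contDiffAt.2 hf)
    (contMDiffAt_extChartAt' hp) (isInvertible_chartD hp) (by norm_cast)

theorem mdifferentiableAt_ofCoords_const
    (hp : p ∈ (chartAt (EuclideanSpace ℝ (Fin m)) x₀).source) (w : EuclideanSpace ℝ (Fin m)) :
    MDifferentiableAt (model m) (model m).tangent
      (fun x ↦ (⟨x, ofCoords x₀ (fun _ ↦ w) x⟩ : TangentBundle (model m) M)) p :=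
  (contMDiffAt_ofCoords hp contDiffAt_const).mdifferentiableAt (by simp)

theorem coords_ofCoords_eventuallyEq
    (hp : p ∈ (chartAt (EuclideanSpace ℝ (Fin m)) x₀).source)
    (f : EuclideanSpace ℝ (Fin m) → EuclideanSpace ℝ (Fin m)) :
    coords x₀ (ofCoords x₀ f) =ᶠ[𝓝 (extChartAt (model m) x₀ p)] f :=
  eventually_extChartAt_symm hp <| by
    filter_upwards [source_mem_nhds hp] with q hq
    exact coords_ofCoords hq f

/-- Lie brackets commute with pullback, and constant fields on the model space commute. -/
theorem mlieBracket_ofCoords_const (hp : p ∈ (chartAt (EuclideanSpace ℝ (Fin m)) x₀).source)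
    (u v : EuclideanSpace ℝ (Fin m)) :
    VectorField.mlieBracket (model m) (ofCoords x₀ fun _ ↦ u) (ofCoords x₀ fun _ ↦ v) p = 0 := by
  have hc (w : EuclideanSpace ℝ (Fin m)) : MDifferentiableAt (model m) (model m).tangent
      (fun y ↦ (⟨y, w⟩ : TangentBundle (model m) (EuclideanSpace ℝ (Fin m))))
      (extChartAt (model m) x₀ p) :=
    (contMDiffAt_vectorSpace_iff_contDiffAt (n := 1) (V := fun _ ↦ w)).2 contDiffAt_const
      |>.mdifferentiableAt (by simp)
  have : IsManifold (model m) (minSmoothness ℝ 2) M := by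
    rw [minSmoothness_of_isRCLikeNormedField]; infer_instance
  have h := VectorField.mpullback_mlieBracket (n := ∞) (hc u) (hc v)
    (contMDiffAt_extChartAt' hp) (by simp; norm_cast)
  let U (w : EuclideanSpace ℝ (Fin m)) : VField m (EuclideanSpace ℝ (Fin m)) := fun _ ↦ w
  have h0 : VectorField.mlieBracket (model m) (U u) (U v) = 0 := by
    rw [← VectorField.mlieBracketWithin_univ, VectorField.mlieBracketWithin_eq_lieBracketWithin]
    ext1 y
    simp only [VectorField.lieBracketWithin, U, fderivWithin_fun_const, Pi.zero_apply, sub_self,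
      zero_apply]
    rfl
  refine h.symm.trans ?_
  change VectorField.mpullback (model m) (model m) _
    (VectorField.mlieBracket (model m) (U u) (U v)) p = 0
  rw [h0, VectorField.mpullback_zero]
  rfl

/-- Christoffel symbols of a connection in the chart at `x₀`: `Γ(y)(u)(w)` is the covariant
derivative in the direction `u` of the vector field that is constantly `w` in the chart. -/
def Connection.christoffel (D : Connection m M) (x₀ : M) (y : EuclideanSpace ℝ (Fin m)) :
    EuclideanSpace ℝ (Fin m) →L[ℝ] EuclideanSpace ℝ (Fin m) →L[ℝ] EuclideanSpace ℝ (Fin m) :=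
  -- Expanding `w` in the standard basis builds in linearity and continuity in `w`. The sum takes
  -- `w` as its first argument, hence the final `flip`.
  (∑ i, (EuclideanSpace.proj i : EuclideanSpace ℝ (Fin m) →L[ℝ] ℝ).smulRight
    (chartD m x₀ ((extChartAt (model m) x₀).symm y) ∘L
      D (ofCoords x₀ fun _ ↦ EuclideanSpace.single i 1) ((extChartAt (model m) x₀).symm y) ∘L
      (chartD m x₀ ((extChartAt (model m) x₀).symm y)).inverse)).flip

theorem Connection.christoffel_extChartAt (D : Connection m M)
    (hp : p ∈ (chartAt (EuclideanSpace ℝ (Fin m)) x₀).source) (u w : EuclideanSpace ℝ (Fin m)) :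
    D.christoffel x₀ (extChartAt (model m) x₀ p) u w = ∑ i, w i • chartD m x₀ p
      (D (ofCoords x₀ fun _ ↦ EuclideanSpace.single i 1) p ((chartD m x₀ p).inverse u)) := by
  rw [Connection.christoffel, (extChartAt (model m) x₀).left_inv (by simpa using hp)]
  simp

theorem fderiv_comp_extChartAt_symm {f : M → ℝ}
    (hp : p ∈ (chartAt (EuclideanSpace ℝ (Fin m)) x₀).source)
    (hf : MDifferentiableAt (model m) 𝓘(ℝ, ℝ) f p) :
    DifferentiableAt ℝ (f ∘ (extChartAt (model m) x₀).symm) (extChartAt (model m) x₀ p) ∧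
    ∀ v : TangentSpace (model m) p, fderiv ℝ (f ∘ (extChartAt (model m) x₀).symm)
      (extChartAt (model m) x₀ p) (chartD m x₀ p v) = mvfderiv (model m) f p v := by
  have hp' : p ∈ (extChartAt (model m) x₀).source := by simpa using hp
  have hs : MDifferentiableAt (model m) (model m) (extChartAt (model m) x₀).symm
      (extChartAt (model m) x₀ p) :=
    ((contMDiffOn_extChartAt_symm (I := model m) (n := ∞) x₀).contMDiffAt
      (extChartAt_target_mem_nhds'
        ((extChartAt (model m) x₀).map_source hp'))).mdifferentiableAt (by simp)
  have hF : MDifferentiableAt (model m) 𝓘(ℝ, ℝ) (f ∘ (extChartAt (model m) x₀).symm)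
      (extChartAt (model m) x₀ p) := by
    refine MDifferentiableAt.comp _ ?_ hs
    rwa [(extChartAt (model m) x₀).left_inv hp']
  refine ⟨hF.differentiableAt, fun v ↦ ?_⟩
  have hφ : MDifferentiableAt (model m) (model m) (extChartAt (model m) x₀) p :=
    mdifferentiableAt_extChartAt hp
  have h1 : f =ᶠ[𝓝 p] (f ∘ (extChartAt (model m) x₀).symm) ∘ extChartAt (model m) x₀ := by
    filter_upwards [source_mem_nhds hp] with q hq
    simp only [Function.comp_apply]
    rw [(extChartAt (model m) x₀).left_inv (by simpa using hq)]
  have h2 := (hF.hasMFDerivAt.comp p hφ.hasMFDerivAt).congr_of_eventuallyEq h1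
  have h3 := DFunLike.congr_fun h2.mfderiv v
  rw [mfderiv_eq_fderiv] at h3
  exact h3.symm

/-- Both terms obey the Leibniz rule with the same derivative of the scalar factor, so it cancels:
the difference of two connections is a tensor. -/
theorem tensorialAt_connection_sub_fderiv (D : Connection m M)
    (hp : p ∈ (chartAt (EuclideanSpace ℝ (Fin m)) x₀).source) (v : TangentSpace (model m) p) :
    TensorialAt (model m) (EuclideanSpace ℝ (Fin m)) (fun X : VField m M ↦
      chartD m x₀ p (D X p v) -
        fderiv ℝ (coords x₀ X) (extChartAt (model m) x₀ p) (chartD m x₀ p v)) p where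
  smul := by
    intro f X hf hX
    obtain ⟨hF, hFv⟩ := fderiv_comp_extChartAt_symm hp hf
    have h := fderiv_smul hF (differentiableAt_coords hp hX)
    have h' : coords x₀ (f • X) = (f ∘ (extChartAt (model m) x₀).symm) • coords x₀ X := by
      ext1 y; exact map_smul (chartD m x₀ _) _ _
    have hpp : (f ∘ (extChartAt (model m) x₀).symm) (extChartAt (model m) x₀ p) = f p := by
      simp only [Function.comp_apply]
      rw [(extChartAt (model m) x₀).left_inv (by simpa using hp)]
    rw [h', h, D.isCovariantDerivativeOn.leibniz hX hf (Set.mem_univ _), hpp,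
      coords_extChartAt hp, add_apply, smul_apply, map_add, map_smul, add_apply, smul_apply,
      ContinuousLinearMap.smulRight_apply, ContinuousLinearMap.smulRight_apply, hFv, map_smul]
    module
  add := by
    intro X Y hX hY
    have h := fderiv_add (differentiableAt_coords hp hX) (differentiableAt_coords hp hY)
    have h' : coords x₀ (X + Y) = coords x₀ X + coords x₀ Y := by
      ext1 y; exact map_add (chartD m x₀ _) _ _
    rw [h', h, D.isCovariantDerivativeOn.add hX hY (Set.mem_univ _)]
    simp
    abel

end Fields

/-! ### Connections and curvature in a chart -/

section Christoffel

variable {m : ℕ} {M : Type*} [TopologicalSpace M] [ChartedSpace (EuclideanSpace ℝ (Fin m)) M]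
  [IsManifold (model m) ∞ M] {x₀ p : M}

theorem fderiv_coords_ofCoords_const
    (hp : p ∈ (chartAt (EuclideanSpace ℝ (Fin m)) x₀).source) (w : EuclideanSpace ℝ (Fin m)) :
    fderiv ℝ (coords x₀ (ofCoords x₀ fun _ ↦ w)) (extChartAt (model m) x₀ p) = 0 := by
  rw [(coords_ofCoords_eventuallyEq hp _).fderiv_eq]
  simp

/-- The expression of a connection in a chart. -/
theorem Connection.chartD_apply (D : Connection m M)
    (hp : p ∈ (chartAt (EuclideanSpace ℝ (Fin m)) x₀).source) {X : VField m M}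
    (hX : MDifferentiableAt (model m) (model m).tangent
      (fun x ↦ (⟨x, X x⟩ : TangentBundle (model m) M)) p) (v : TangentSpace (model m) p) :
    chartD m x₀ p (D X p v) =
      fderiv ℝ (coords x₀ X) (extChartAt (model m) x₀ p) (chartD m x₀ p v) +
      D.christoffel x₀ (extChartAt (model m) x₀ p) (chartD m x₀ p v) (chartD m x₀ p (X p)) := by
  have hT := tensorialAt_connection_sub_fderiv D hp v
  set w := chartD m x₀ p (X p) with hw
  set e : Fin m → VField m M := fun i ↦ ofCoords x₀ fun _ ↦ EuclideanSpace.single i 1 with he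
  have hed (i : Fin m) : MDifferentiableAt (model m) (model m).tangent
      (fun x ↦ (⟨x, e i x⟩ : TangentBundle (model m) M)) p := mdifferentiableAt_ofCoords_const hp _
  have hcd (i : Fin m) : MDifferentiableAt (model m) 𝓘(ℝ, ℝ) (fun _ : M ↦ w i) p :=
    mdifferentiableAt_const
  have hsd (i : Fin m) := (hcd i).smul_section (hed i)
  -- By tensoriality only `X p` matters, so `X` may be replaced by a combination of coordinate
  -- fields with coefficients frozen at `p`.
  have hXe : X p = ∑ i, ((fun _ : M ↦ w i) • e i : VField m M) p := by
    apply chartD_injective hp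
    rw [← hw, map_sum]
    have h1 (i : Fin m) : chartD m x₀ p (((fun _ : M ↦ w i) • e i : VField m M) p) =
        w i • EuclideanSpace.single i 1 := by
      rw [Pi.smul_apply', map_smul, he]
      simp only
      rw [ofCoords_apply, chartD_inverse_apply hp]
    simp_rw [h1]
    ext j
    simp [Pi.single_apply]
  have h1 := hT.pointwise hX (σ' := fun q ↦ ∑ i, ((fun _ : M ↦ w i) • e i : VField m M) q)
    (.sum_section fun i _ ↦ hsd i) hXe
  rw [hT.sum _ fun i _ ↦ hsd i] at h1
  have h2 (i : Fin m) := hT.smul (hcd i) (hed i)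
  simp only [h2] at h1
  rw [sub_eq_iff_eq_add'] at h1
  rw [h1, D.christoffel_extChartAt hp, inverse_chartD_apply hp]
  congr 1
  refine Finset.sum_congr rfl fun i _ ↦ ?_
  rw [he]
  simp only
  rw [fderiv_coords_ofCoords_const hp]
  simp

theorem SmoothOn.contMDiffAt {X : VField m M} {U : Set M} (hX : SmoothOn X U) (hU : IsOpen U)
    (hp : p ∈ U) : ContMDiffAt (model m) (model m).tangent ∞
      (fun x ↦ (⟨x, X x⟩ : TangentBundle (model m) M)) p :=
  ContMDiffOn.contMDiffAt hX (hU.mem_nhds hp)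

theorem SmoothOn.mdifferentiableAt {X : VField m M} {U : Set M} (hX : SmoothOn X U)
    (hU : IsOpen U) (hp : p ∈ U) : MDifferentiableAt (model m) (model m).tangent
      (fun x ↦ (⟨x, X x⟩ : TangentBundle (model m) M)) p :=
  (hX.contMDiffAt hU hp).mdifferentiableAt (by simp)

theorem smoothOn_ofCoords {f : EuclideanSpace ℝ (Fin m) → EuclideanSpace ℝ (Fin m)}
    {t : Set (EuclideanSpace ℝ (Fin m))} (ht : IsOpen t) (hf : ContDiffOn ℝ ∞ f t) :
    SmoothOn (ofCoords x₀ f)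
      ((chartAt (EuclideanSpace ℝ (Fin m)) x₀).source ∩ extChartAt (model m) x₀ ⁻¹' t) :=
  fun _ hq ↦ (contMDiffAt_ofCoords hq.1
    (hf.contDiffAt (ht.mem_nhds hq.2))).contMDiffWithinAt

theorem smoothOn_ofCoords_const (w : EuclideanSpace ℝ (Fin m)) :
    SmoothOn (ofCoords x₀ fun _ ↦ w) (chartAt (EuclideanSpace ℝ (Fin m)) x₀).source := by
  simpa using smoothOn_ofCoords (x₀ := x₀) isOpen_univ (f := fun _ ↦ w) contDiffOn_const

theorem Connection.christoffel_eq_chartD (D : Connection m M)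
    (hp : p ∈ (chartAt (EuclideanSpace ℝ (Fin m)) x₀).source) (u w : EuclideanSpace ℝ (Fin m)) :
    D.christoffel x₀ (extChartAt (model m) x₀ p) u w =
      chartD m x₀ p (D.nabla (ofCoords x₀ fun _ ↦ u) (ofCoords x₀ fun _ ↦ w) p) := by
  have h := D.chartD_apply hp (mdifferentiableAt_ofCoords_const hp w) (ofCoords x₀ (fun _ ↦ u) p)
  rw [fderiv_coords_ofCoords_const hp, ofCoords_apply, ofCoords_apply, chartD_inverse_apply hp,
    chartD_inverse_apply hp, zero_apply, zero_add] at h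
  exact h.symm

/-- Christoffel symbols of torsion-free connections are symmetric. -/
theorem Connection.christoffel_symm {D : Connection m M} (hD : D.torsion = 0)
    (hp : p ∈ (chartAt (EuclideanSpace ℝ (Fin m)) x₀).source) (u w : EuclideanSpace ℝ (Fin m)) :
    D.christoffel x₀ (extChartAt (model m) x₀ p) u w =
      D.christoffel x₀ (extChartAt (model m) x₀ p) w u := by
  have h := D.torsion_eq_zero_iff.1 hD (mdifferentiableAt_ofCoords_const hp u)
    (mdifferentiableAt_ofCoords_const hp w)
  rw [mlieBracket_ofCoords_const hp, sub_eq_zero] at h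
  rw [D.christoffel_eq_chartD hp, D.christoffel_eq_chartD hp]
  exact congrArg (chartD m x₀ p) h

theorem Connection.coords_nabla (D : Connection m M) {X Y : VField m M}
    (hp : p ∈ (chartAt (EuclideanSpace ℝ (Fin m)) x₀).source)
    (hY : MDifferentiableAt (model m) (model m).tangent
      (fun x ↦ (⟨x, Y x⟩ : TangentBundle (model m) M)) p) :
    coords x₀ (D.nabla X Y) (extChartAt (model m) x₀ p) =
      coordNabla (D.christoffel x₀) (coords x₀ X) (coords x₀ Y) (extChartAt (model m) x₀ p) := by
  rw [coordNabla, coords_extChartAt hp, coords_extChartAt hp, coords_extChartAt hp]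
  exact D.chartD_apply hp hY (X p)

variable [T2Space M]

/-- A vector field that is smooth near a point agrees there with a globally smooth one. -/
theorem exists_smooth_eventuallyEq {X : VField m M} {U : Set M} (hU : IsOpen U) (hp : p ∈ U)
    (hX : SmoothOn X U) : ∃ X' : VField m M, SmoothOn X' Set.univ ∧ ∀ᶠ q in 𝓝 p, X' q = X q := by
  obtain ⟨ψ, -, hψ⟩ := (SmoothBumpFunction.nhds_basis_tsupport (I := model m) p).mem_iff.1
    (hU.mem_nhds hp)
  refine ⟨(ψ : M → ℝ) • X, ?_, ?_⟩
  · exact (ContMDiffOn.smul_section_of_tsupport (ψ.contMDiff.contMDiffOn) hU hψ hX).contMDiffOn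
  · filter_upwards [ψ.eventuallyEq_one] with q hq
    simp [hq]

/-- Covariant derivatives of smooth vector fields are smooth. -/
theorem Connection.smoothOn_nabla {D : Connection m M}
    (hD : CovariantDerivative.ContMDiffCovariantDerivative D ∞) {X Y : VField m M} {U : Set M}
    (hU : IsOpen U) (hX : SmoothOn X U) (hY : SmoothOn Y U) : SmoothOn (D.nabla X Y) U := by
  intro p hp
  -- Smoothness of the connection is applied to a globally smooth section; locality then brings the
  -- result back to `Y`.
  obtain ⟨Y', hY', hYY'⟩ := exists_smooth_eventuallyEq hU hp hY
  have h1 := hD.contMDiff.contMDiff (σ := Y') hY'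
  have h2 : ContMDiffAt (model m) (model m).tangent ∞
      (fun x ↦ (⟨x, D Y' x (X x)⟩ : TangentBundle (model m) M)) p :=
    ContMDiffAt.clm_bundle_apply (h1.contMDiffAt Filter.univ_mem) (hX.contMDiffAt hU hp)
  refine (h2.congr_of_eventuallyEq ?_).contMDiffWithinAt
  filter_upwards [hYY'.eventually_nhds, hU.mem_nhds hp] with q hq hqU
  have h3 := D.isCovariantDerivativeOnUniv.congr_of_eventuallyEq
    (hY'.mdifferentiableAt isOpen_univ (Set.mem_univ q)) (hY.mdifferentiableAt hU hqU)
    Filter.univ_mem hq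
  rw [Connection.nabla, h3]

/-- In finite dimension smoothness may be tested on fixed vectors `u`, `w`, where the symbol is the
expression of a covariant derivative of smooth coordinate fields. -/
theorem Connection.contDiffOn_christoffel {D : Connection m M}
    (hD : CovariantDerivative.ContMDiffCovariantDerivative D ∞) (x₀ : M) :
    ContDiffOn ℝ ∞ (D.christoffel x₀) (extChartAt (model m) x₀).target := by
  refine contDiffOn_clm_apply.2 fun u ↦ contDiffOn_clm_apply.2 fun w ↦ ?_
  have hopen := (chartAt (EuclideanSpace ℝ (Fin m)) x₀).open_source
  have hsm := D.smoothOn_nabla hD hopen (smoothOn_ofCoords_const u) (smoothOn_ofCoords_const w)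
  have hsrc {y : EuclideanSpace ℝ (Fin m)} (hy : y ∈ (extChartAt (model m) x₀).target) :
      (extChartAt (model m) x₀).symm y ∈ (chartAt (EuclideanSpace ℝ (Fin m)) x₀).source := by
    simpa using (extChartAt (model m) x₀).map_target hy
  have h1 : ContDiffOn ℝ ∞ (coords x₀ (D.nabla (ofCoords x₀ fun _ ↦ u) (ofCoords x₀ fun _ ↦ w)))
      (extChartAt (model m) x₀).target := by
    intro y hy
    have h2 := contDiffAt_coords (hsrc hy) (hsm.contMDiffAt hopen (hsrc hy))
    rw [(extChartAt (model m) x₀).right_inv hy] at h2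
    exact h2.contDiffWithinAt
  refine h1.congr fun y hy ↦ ?_
  have h3 := D.christoffel_eq_chartD (hsrc hy) u w
  rwa [(extChartAt (model m) x₀).right_inv hy] at h3

/-- The expression of the curvature in a chart. -/
theorem Connection.IsSymmetric.chartD_curv {D : Connection m M} (hD : D.IsSymmetric)
    {X Y Z : VField m M} {U : Set M} (hU : IsOpen U) (hX : SmoothOn X U) (hY : SmoothOn Y U)
    (hZ : SmoothOn Z U) (hpU : p ∈ U)
    (hp : p ∈ (chartAt (EuclideanSpace ℝ (Fin m)) x₀).source) :
    chartD m x₀ p (D.curv X Y Z p) = coordCurv (D.christoffel x₀) (extChartAt (model m) x₀ p)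
      (chartD m x₀ p (X p)) (chartD m x₀ p (Y p)) (chartD m x₀ p (Z p)) := by
  have hev {X Y : VField m M} (hY : SmoothOn Y U) : coords x₀ (D.nabla X Y)
      =ᶠ[𝓝 (extChartAt (model m) x₀ p)]
        coordNabla (D.christoffel x₀) (coords x₀ X) (coords x₀ Y) := by
    apply eventually_extChartAt_symm hp
    filter_upwards [hU.mem_nhds hpU, source_mem_nhds hp] with q hqU hq
    exact D.coords_nabla hq (hY.mdifferentiableAt hU hqU)
  have hnn {X Y Z : VField m M} (hY : SmoothOn Y U) (hZ : SmoothOn Z U) :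
      chartD m x₀ p (D.nabla X (D.nabla Y Z) p) = coordNabla (D.christoffel x₀) (coords x₀ X)
        (coordNabla (D.christoffel x₀) (coords x₀ Y) (coords x₀ Z))
        (extChartAt (model m) x₀ p) := by
    rw [← coords_extChartAt hp, D.coords_nabla hp
      ((D.smoothOn_nabla hD.smooth hU hY hZ).mdifferentiableAt hU hpU), coordNabla,
      (hev hZ).fderiv_eq, (hev hZ).eq_of_nhds]
    rfl
  have hbr : chartD m x₀ p (VectorField.mlieBracket (model m) X Y p) =
      coordNabla (D.christoffel x₀) (coords x₀ X) (coords x₀ Y) (extChartAt (model m) x₀ p) -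
      coordNabla (D.christoffel x₀) (coords x₀ Y) (coords x₀ X) (extChartAt (model m) x₀ p) := by
    rw [← D.torsion_eq_zero_iff.1 hD.torsion_eq_zero (hX.mdifferentiableAt hU hpU)
      (hY.mdifferentiableAt hU hpU), map_sub, ← D.coords_nabla hp (hY.mdifferentiableAt hU hpU),
      ← D.coords_nabla hp (hX.mdifferentiableAt hU hpU), coords_extChartAt hp,
      coords_extChartAt hp]
    rfl
  have hp' : p ∈ (extChartAt (model m) x₀).source := by simpa using hp
  have hΓ : ContDiffAt ℝ ∞ (D.christoffel x₀) (extChartAt (model m) x₀ p) :=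
    (D.contDiffOn_christoffel hD.smooth x₀).contDiffAt
      (extChartAt_target_mem_nhds' ((extChartAt (model m) x₀).map_source hp'))
  have key := coordNabla_commutator hΓ (D.christoffel_symm hD.torsion_eq_zero hp)
    (contDiffAt_coords hp (hX.contMDiffAt hU hpU)) (contDiffAt_coords hp (hY.contMDiffAt hU hpU))
    (contDiffAt_coords hp (hZ.contMDiffAt hU hpU))
  rw [← coords_extChartAt hp X, ← coords_extChartAt hp Y, ← coords_extChartAt hp Z, ← key,
    ← hnn hY hZ, ← hnn hX hZ, ← hbr, coords_extChartAt hp Z,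
    ← D.chartD_apply hp (hZ.mdifferentiableAt hU hpU), ← map_sub, ← map_sub]
  rfl

end Christoffel

/-! ### Flatness and solutions of `∇²X = 0` -/

section Flatness

variable {m : ℕ} {M : Type*} [TopologicalSpace M] [ChartedSpace (EuclideanSpace ℝ (Fin m)) M]

theorem finrank_tangentSpace (x : M) : Module.finrank ℝ (TangentSpace (model m) x) = m :=
  finrank_euclideanSpace_fin (𝕜 := ℝ) (n := m)

variable [IsManifold (model m) ∞ M] {x : M}

/-- The Ricci identity: the skew part of the Hessian of a vector field is the curvature. -/
theorem Connection.curv_eq_hess_sub_hess {D : Connection m M} (hD : D.torsion = 0)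
    {X Y Z : VField m M} (hY : SmoothOn Y Set.univ) (hZ : SmoothOn Z Set.univ) :
    D.curv Y Z X x = D.hess X Y Z x - D.hess X Z Y x := by
  have h := D.torsion_eq_zero_iff.1 hD (hY.mdifferentiableAt isOpen_univ (Set.mem_univ x))
    (hZ.mdifferentiableAt isOpen_univ (Set.mem_univ x))
  have h' : D.nabla (VectorField.mlieBracket (model m) Y Z) X x =
      D.nabla (D.nabla Y Z) X x - D.nabla (D.nabla Z Y) X x := by
    rw [Connection.nabla, ← h, map_sub]
    rfl
  simp only [Connection.curv, Connection.hess, Pi.sub_apply, h']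
  abel

variable [T2Space M]

/-- If the solutions of `∇²X = 0` span every tangent space, the connection is flat. -/
theorem Connection.IsSymmetric.isLocallyFlat_of_solSpan_eq_top {D : Connection m M}
    (hD : D.IsSymmetric) (h : ∀ x, D.solSpan x = ⊤) : D.IsLocallyFlat := by
  refine ⟨hD, fun X Y Z hX hY hZ ↦ funext fun x ↦ ?_⟩
  have hx : x ∈ (chartAt (EuclideanSpace ℝ (Fin m)) x).source := mem_chart_source _ x
  have hmono {V : VField m M} (hV : SmoothOn V Set.univ) (U : Set M) : SmoothOn V U :=
    ContMDiffOn.mono hV (Set.subset_univ U)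
  -- The coordinate form depends only on the values at `x` and is linear in `v`, so vanishing on
  -- values of solutions extends to their span.
  have hker : ∀ v ∈ D.solSpan x, coordCurv (D.christoffel x) (extChartAt (model m) x x)
      (chartD m x x (X x)) (chartD m x x (Y x)) (chartD m x x v) = 0 := by
    intro v hv
    induction hv using Submodule.span_induction with
    | mem v hv =>
      obtain ⟨U, W, hU, hxU, hW, rfl⟩ := hv
      rw [← hD.chartD_curv hU (hmono hX U) (hmono hY U) hW.smooth hxU hx,
        D.curv_eq_hess_sub_hess hD.torsion_eq_zero hX hY, hW.hess_eq_zero X Y hX hY x hxU,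
        hW.hess_eq_zero Y X hY hX x hxU, sub_zero, map_zero]
    | zero => simp [coordCurv]
    | add v w _ _ hv hw =>
      rw [← add_zero (0 : EuclideanSpace ℝ (Fin m))]
      nth_rewrite 1 [← hv]
      rw [← hw]
      simp only [coordCurv, map_add]
      abel
    | smul c v _ hv =>
      rw [← smul_zero c, ← hv]
      simp only [coordCurv, map_smul]
      module
  apply chartD_injective hx
  rw [hD.chartD_curv isOpen_univ hX hY hZ (Set.mem_univ x) hx, hker _ (by simp [h])]
  exact (map_zero _).symm

theorem Connection.IsLocallyFlat.coordCurv_christoffel {D : Connection m M}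
    (hD : D.IsLocallyFlat) {x₀ : M} {y : EuclideanSpace ℝ (Fin m)}
    (hy : y ∈ (extChartAt (model m) x₀).target) (u v w : EuclideanSpace ℝ (Fin m)) :
    coordCurv (D.christoffel x₀) y u v w = 0 := by
  obtain ⟨p, hp', rfl⟩ : ∃ p ∈ (extChartAt (model m) x₀).source, extChartAt (model m) x₀ p = y :=
    ⟨_, (extChartAt (model m) x₀).map_target hy, (extChartAt (model m) x₀).right_inv hy⟩
  have hp : p ∈ (chartAt (EuclideanSpace ℝ (Fin m)) x₀).source := by simpa using hp'
  have hopen := (chartAt (EuclideanSpace ℝ (Fin m)) x₀).open_source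
  -- Flatness is tested on global fields only, so coordinate fields are cut off away from `p`.
  have hex (u : EuclideanSpace ℝ (Fin m)) :
      ∃ X : VField m M, SmoothOn X Set.univ ∧ chartD m x₀ p (X p) = u := by
    obtain ⟨X, hX, hXu⟩ := exists_smooth_eventuallyEq hopen hp (smoothOn_ofCoords_const u)
    exact ⟨X, hX, by rw [hXu.self_of_nhds, ofCoords_apply, chartD_inverse_apply hp]⟩
  obtain ⟨X, hX, rfl⟩ := hex u
  obtain ⟨Y, hY, rfl⟩ := hex v
  obtain ⟨Z, hZ, rfl⟩ := hex w
  rw [← hD.toIsSymmetric.chartD_curv isOpen_univ hX hY hZ (Set.mem_univ p) hp,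
    hD.curv_eq_zero X Y Z hX hY hZ]
  exact map_zero _

/-- A locally flat structure has a local parallel vector field with any prescribed value. -/
theorem Connection.IsLocallyFlat.exists_parallel {D : Connection m M} (hD : D.IsLocallyFlat)
    (v : TangentSpace (model m) x) : ∃ (U : Set M) (X : VField m M), IsOpen U ∧ x ∈ U ∧
      SmoothOn X U ∧ (∀ p ∈ U, D X p = 0) ∧ X x = v := by
  have hx : x ∈ (chartAt (EuclideanSpace ℝ (Fin m)) x).source := mem_chart_source _ x
  have htgt : IsOpen (extChartAt (model m) x).target := isOpen_extChartAt_target x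
  have hΓ := D.contDiffOn_christoffel hD.smooth x
  obtain ⟨t, f, ht, hxt, htsub, hfx, hf, hf'⟩ := exists_solution_of_flat_linear_system htgt
    -- `∇X = 0` reads `df(u) = -Γ(u)(f)`; its integrability condition is the vanishing of
    -- `coordCurv` with `u` and `v` exchanged.
    (A := fun y ↦ -D.christoffel x y) hΓ.neg (fun y hy u v w ↦ by
      have h := hD.coordCurv_christoffel hy v u w
      simp only [coordCurv] at h
      simp only [fderiv_fun_neg, neg_apply, map_neg, neg_neg]
      rw [← sub_eq_zero, ← h]
      abel) (mem_extChartAt_target x) (chartD m x x v)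
  have hUo : IsOpen ((chartAt (EuclideanSpace ℝ (Fin m)) x).source ∩
      extChartAt (model m) x ⁻¹' t) := by
    simpa using isOpen_extChartAt_preimage (I := model m) x ht
  refine ⟨_, ofCoords x f, hUo, ⟨hx, hxt⟩, smoothOn_ofCoords ht hf, fun p hp ↦ ?_, ?_⟩
  · ext1 u
    apply chartD_injective hp.1
    rw [D.chartD_apply hp.1 ((smoothOn_ofCoords ht hf).mdifferentiableAt hUo hp),
      (coords_ofCoords_eventuallyEq hp.1 f).fderiv_eq, (hf' _ hp.2).fderiv, ofCoords_apply,
      chartD_inverse_apply hp.1]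
    simp
  · rw [ofCoords_apply, hfx, inverse_chartD_apply hx]

/-- Parallel fields solve `∇²X = 0`: both terms of the Hessian differentiate something that vanishes
identically or is parallel. -/
theorem Connection.IsLocallyFlat.solSpan_eq_top {D : Connection m M} (hD : D.IsLocallyFlat)
    (x : M) : D.solSpan x = ⊤ := by
  refine Submodule.eq_top_iff'.2 fun v ↦ Submodule.subset_span ?_
  obtain ⟨U, X, hU, hxU, hX, hpar, hv⟩ := hD.exists_parallel v
  refine ⟨U, X, hU, hxU, ⟨hX, fun Y Z hY hZ p hp ↦ ?_⟩, hv⟩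
  have hZX : ∀ᶠ q in 𝓝 p, D.nabla Z X q = (0 : VField m M) q := by
    filter_upwards [hU.mem_nhds hp] with q hq
    rw [Connection.nabla, hpar q hq]
    rfl
  have hdiff := (D.smoothOn_nabla hD.smooth hU (ContMDiffOn.mono hZ (Set.subset_univ U))
    hX).mdifferentiableAt hU hp
  -- `∇_Z X` vanishes near `p`, and a covariant derivative depends only on the germ.
  have h1 : D (D.nabla Z X) p = 0 := by
    refine (D.isCovariantDerivativeOnUniv.congr_of_eventuallyEq (σ' := 0) hdiff
      (Bundle.mdifferentiableAt_zeroSection ..) Filter.univ_mem hZX).trans ?_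
    exact D.isCovariantDerivativeOnUniv.zero (Set.mem_univ p)
  simp only [Connection.hess, Pi.sub_apply]
  rw [Connection.nabla, Connection.nabla, h1, hpar p hp]
  simp

end Flatness

end LocallyFlat

end

/-! ### The equivalence -/

theorem mainTheorem1 (m : ℕ) (M : Type*) [TopologicalSpace M] [T2Space M] [ParacompactSpace M]
    [ConnectedSpace M] [ChartedSpace (EuclideanSpace ℝ (Fin m)) M]
    [IsManifold (LocallyFlat.model m) ∞ M] :
    LocallyFlat.rbManifold m M = 0 ↔
      ∃ D : LocallyFlat.Connection m M, D.IsLocallyFlat := by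
  constructor
  · intro h
    obtain ⟨⟨D, hD⟩, hDm⟩ := ENat.iInf_eq_zero.1 h
    -- Truncated subtraction vanishes exactly under this inequality.
    have hDm' : m ≤ D.rb := by
      rw [Nat.cast_eq_zero] at hDm
      exact Nat.sub_eq_zero_iff_le.1 hDm
    refine ⟨D, hD.isLocallyFlat_of_solSpan_eq_top fun x ↦ ?_⟩
    have : FiniteDimensional ℝ (TangentSpace (LocallyFlat.model m) x) :=
      inferInstanceAs (FiniteDimensional ℝ (EuclideanSpace ℝ (Fin m)))
    refine Submodule.eq_top_of_finrank_eq (le_antisymm (Submodule.finrank_le _) ?_)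
    rw [LocallyFlat.finrank_tangentSpace]
    exact hDm'.trans (ciInf_le (OrderBot.bddBelow _) x)
  · rintro ⟨D, hD⟩
    have hrb : D.rb = m := by
      have h (x : M) : Module.finrank ℝ (D.solSpan x) = m := by
        rw [hD.solSpan_eq_top, finrank_top, LocallyFlat.finrank_tangentSpace]
      -- The infimum of a constant needs `M` nonempty, which connectedness includes.
      simp only [LocallyFlat.Connection.rb, h, ciInf_const]
    refine ENat.iInf_eq_zero.2 ⟨⟨D, hD.toIsSymmetric⟩, ?_⟩
    simp [hrb]
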